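/- There is a universal constant $c>0$ such that the following holds. Let $d_{\mathrm{in}}, d_{\mathrm{out}}$ be dimensions with $d_{\mathrm{out}}\ge 2$, let $\mathcal N:\mathbb C^{d_{\mathrm{in}}\times d_{\mathrm{in}}}\to\mathbb C^{d_{\mathrm{out}}\times d_{\mathrm{out}}}$ be any fixed quantum channel (completely positive trace-preserving linear map), and let $0<\varepsilon\le 2(1-1/d_{\mathrm{out}})$ (in particular, any $0<\varepsilon\le 1$ is allowed). Suppose that a (possibly randomized) ancilla-assisted, coherent, adaptive tester making $n$ queries accepts $\mathcal M$ with probability at least $2/3$ if $\mathcal M=\mathcal N$, and rejects $\mathcal M$ with probability at least $2/3$ for every channel $\mathcal M:\mathbb C^{d_{\mathrm{in}}\times d_{\mathrm{in}}}\to\mathbb C^{d_{\mathrm{out}}\times d_{\mathrm{out}}}$ with $\|\mathcal M-\mathcal N\|_\diamond\ge\varepsilon$. Then $$n\ \ge\ c\,\frac{\sqrt{d_{\mathrm{in}}}}{\varepsilon}.$$ Here a deterministic ancilla-assisted, coherent, adaptive tester making $n$ queries consists of an ancilla dimension $d_{\mathrm{anc}}\ge1$, channels $\mathcal V_1,\dots,\mathcal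 V_n$ from $\mathbb C^{d_{\mathrm{out}}\times d_{\mathrm{out}}}\otimes\mathbb C^{d_{\mathrm{anc}}\times d_{\mathrm{anc}}}$ to $\mathbb C^{d_{\mathrm{in}}\times d_{\mathrm{in}}}\otimes\mathbb C^{d_{\mathrm{anc}}\times d_{\mathrm{anc}}}$, and a two-outcome POVM (accept, reject), which is measured on the state $(\mathcal M\otimes\mathcal I)\mathcal V_n(\mathcal M\otimes\mathcal I)\mathcal V_{n-1}\cdots(\mathcal M\otimes\mathcal I)\mathcal V_1(|0\rangle\langle0|)$; a randomized tester is a random choice of a deterministic tester, made independently of $\mathcal M$. The diamond norm of a linear map $\mathcal L:\mathbb C^{d_{\mathrm{in}}\times d_{\mathrm{in}}}\to\mathbb C^{d_{\mathrm{out}}\times d_{\mathrm{out}}}$ is $\|\mathcal L\|_\diamond=\max_{\|X\|_1\le1}\|(\mathcal L\otimes\mathcal I_{d_{\mathrm{in}}})(X)\|_1$, where $\|\cdot\|_1$ is the trace norm (sum of singular values). -/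

import Mathlib

open scoped ComplexOrder Kronecker

/-- The trace norm of a square complex matrix `A`: the sum of its singular values, that is, of the
square roots of the eigenvalues (with multiplicity) of `Aᴴ * A`. -/
noncomputable def traceNorm {ι : Type*} [Fintype ι] [DecidableEq ι] (A : Matrix ι ι ℂ) : ℝ :=
  ∑ i, Real.sqrt ((Matrix.isHermitian_conjTranspose_mul_self A).eigenvalues i)

/-- Superoperators: linear maps from `ι × ι` complex matrices to `κ × κ` complex matrices. -/
abbrev Superop (ι κ : Type*) := Matrix ι ι ℂ →ₗ[ℂ] Matrix κ κ ℂ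

/-- The trivial extension `L ⊗ I` of a superoperator `L` by an ancillary register with basis `α`:
each `(s, t)` block of the input is mapped by `L`. -/
def tensorId (α : Type*) {ι κ : Type*} (L : Superop ι κ) : Superop (ι × α) (κ × α) where
  toFun X := Matrix.of fun p q => L (Matrix.of fun i j => X (i, p.2) (j, q.2)) p.1 q.1
  map_add' X Y := by
    ext p q
    exact congrFun (congrFun (L.map_add (Matrix.of fun i j => X (i, p.2) (j, q.2))
      (Matrix.of fun i j => Y (i, p.2) (j, q.2))) p.1) q.1
  map_smul' c X := by
    ext p q
    exact congrFun (congrFun (L.map_smul c (Matrix.of fun i j => X (i, p.2) (j, q.2))) p.1) q.1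

theorem tensorId_kronecker {α ι κ : Type*} (L : Superop ι κ) (A : Matrix ι ι ℂ)
    (B : Matrix α α ℂ) : tensorId α L (A ⊗ₖ B) = L A ⊗ₖ B := by
  ext p q
  have h : (Matrix.of fun i j => (A ⊗ₖ B) (i, p.2) (j, q.2)) = B p.2 q.2 • A := by
    ext i j
    simp [Matrix.kroneckerMap_apply, mul_comm]
  change L (Matrix.of fun i j => (A ⊗ₖ B) (i, p.2) (j, q.2)) p.1 q.1 = _
  rw [h, L.map_smul]
  simp [Matrix.kroneckerMap_apply, mul_comm]

/-- A (quantum) channel is a completely positive, trace-preserving superoperator. -/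
structure IsChannel {ι κ : Type*} [Fintype ι] [Fintype κ] (L : Superop ι κ) : Prop where
  completelyPositive : ∀ (k : ℕ) (X : Matrix (ι × Fin k) (ι × Fin k) ℂ),
    X.PosSemidef → (tensorId (Fin k) L X).PosSemidef
  tracePreserving : ∀ X : Matrix ι ι ℂ, (L X).trace = X.trace

/-- The induced trace norm of a superoperator: the supremum (in fact a maximum, see
`bddAbove_inducedTraceNorm`) of `‖L X‖₁` over `‖X‖₁ ≤ 1`. -/
noncomputable def inducedTraceNorm {ι κ : Type*} [Fintype ι] [DecidableEq ι] [Fintype κ]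
    [DecidableEq κ] (L : Superop ι κ) : ℝ :=
  sSup ((fun X => traceNorm (L X)) '' {X | traceNorm X ≤ 1})

/-- The diamond norm `‖L‖_⋄ = ‖L ⊗ I‖₁`, with an ancilla of the dimension of the input of `L`. -/
noncomputable def diamondNorm {ι κ : Type*} [Fintype ι] [DecidableEq ι] [Fintype κ]
    [DecidableEq κ] (L : Superop ι κ) : ℝ :=
  inducedTraceNorm (tensorId ι L)

theorem sum_eigenvalues_eq_re_trace {ι : Type*} [Fintype ι] [DecidableEq ι] (A : Matrix ι ι ℂ) :
    ∑ i, (Matrix.isHermitian_conjTranspose_mul_self A).eigenvalues i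
      = (A.conjTranspose * A).trace.re := by
  rw [(Matrix.isHermitian_conjTranspose_mul_self A).trace_eq_sum_eigenvalues]
  simp

theorem traceNorm_le_card_add {ι : Type*} [Fintype ι] [DecidableEq ι] (A : Matrix ι ι ℂ) :
    traceNorm A ≤ Fintype.card ι + (A.conjTranspose * A).trace.re := by
  rw [← sum_eigenvalues_eq_re_trace, traceNorm]
  have h : (Fintype.card ι : ℝ) = ∑ _i : ι, (1 : ℝ) := by simp
  rw [h, ← Finset.sum_add_distrib]
  refine Finset.sum_le_sum fun i _ => ?_
  have h0 := Matrix.eigenvalues_conjTranspose_mul_self_nonneg A i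
  nlinarith [Real.sq_sqrt h0, Real.sqrt_nonneg
    ((Matrix.isHermitian_conjTranspose_mul_self A).eigenvalues i)]

theorem norm_entry_le_traceNorm {ι : Type*} [Fintype ι] [DecidableEq ι] (A : Matrix ι ι ℂ)
    (i j : ι) : ‖A i j‖ ≤ traceNorm A := by
  have hn : 0 ≤ traceNorm A := Finset.sum_nonneg fun i _ => Real.sqrt_nonneg _
  refine abs_le_of_sq_le_sq' ?_ hn |>.2
  have h1 : (A.conjTranspose * A).trace.re ≤ traceNorm A ^ 2 := by
    rw [← sum_eigenvalues_eq_re_trace, traceNorm]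
    refine le_trans (le_of_eq ?_) (Finset.sum_sq_le_sq_sum_of_nonneg fun i _ => Real.sqrt_nonneg _)
    exact Finset.sum_congr rfl fun i _ =>
      (Real.sq_sqrt (Matrix.eigenvalues_conjTranspose_mul_self_nonneg A i)).symm
  have h2 : (A.conjTranspose * A).trace.re = ∑ b, ∑ a, ‖A a b‖ ^ 2 := by
    simp [Matrix.trace, Matrix.mul_apply, ← Complex.normSq_eq_norm_sq, Complex.normSq_apply]
  refine le_trans ?_ h1
  rw [h2]
  calc ‖A i j‖ ^ 2 ≤ ∑ a, ‖A a j‖ ^ 2 :=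
        Finset.single_le_sum (f := fun a => ‖A a j‖ ^ 2) (fun _ _ => by positivity)
          (Finset.mem_univ i)
    _ ≤ _ := Finset.single_le_sum (f := fun b => ∑ a, ‖A a b‖ ^ 2)
          (fun _ _ => by positivity) (Finset.mem_univ j)

/-- The supremum defining the induced trace norm is over a bounded set of reals. -/
theorem bddAbove_inducedTraceNorm {ι κ : Type*} [Fintype ι] [DecidableEq ι] [Fintype κ]
    [DecidableEq κ] (L : Superop ι κ) :
    BddAbove ((fun X => traceNorm (L X)) '' {X | traceNorm X ≤ 1}) := by
  have hK : IsCompact {X : Matrix ι ι ℂ | ∀ i j, X i j ∈ Metric.closedBall (0 : ℂ) 1} := by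
    have h := isCompact_univ_pi (X := fun _ : ι => ι → ℂ)
      (s := fun _ => Set.univ.pi fun _ => Metric.closedBall (0 : ℂ) 1)
      fun _ => isCompact_univ_pi fun _ => isCompact_closedBall (0 : ℂ) 1
    have he : {X : Matrix ι ι ℂ | ∀ i j, X i j ∈ Metric.closedBall (0 : ℂ) 1} =
        (Set.univ.pi fun _ => Set.univ.pi fun _ => Metric.closedBall (0 : ℂ) 1 :
          Set (ι → ι → ℂ)) :=
      Set.ext fun X => ⟨fun hX i _ j _ => hX i j, fun hX i j => hX i trivial j trivial⟩
    rw [he]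
    exact h
  have hL : Continuous L := L.continuous_of_finiteDimensional
  have hc : Continuous fun X : Matrix ι ι ℂ =>
      (Fintype.card κ : ℝ) + ((L X).conjTranspose * L X).trace.re := by fun_prop
  obtain ⟨C, hC⟩ := (hK.image hc).bddAbove
  refine ⟨C, ?_⟩
  rintro _ ⟨X, hX, rfl⟩
  refine (traceNorm_le_card_add _).trans (hC ⟨X, fun i j => ?_, rfl⟩)
  rw [mem_closedBall_zero_iff]
  exact (norm_entry_le_traceNorm X i j).trans hX

/-- The state `|0⟩⟨0|` on the output register together with the ancilla. -/
def zeroState (dout danc : ℕ) : Matrix (Fin dout × Fin danc) (Fin dout × Fin danc) ℂ :=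
  Matrix.of fun p q =>
    if p.1.val = 0 ∧ p.2.val = 0 ∧ q.1.val = 0 ∧ q.2.val = 0 then 1 else 0

/-- A deterministic ancilla-assisted, coherent, adaptive channel tester making `n` queries: channels
`V 0, …, V (n - 1)` applied before the successive queries, and a final two-outcome POVM. -/
structure Tester (din dout n : ℕ) where
  danc : ℕ
  danc_pos : 0 < danc
  V : Fin n → Superop (Fin dout × Fin danc) (Fin din × Fin danc)
  V_channel : ∀ j, IsChannel (V j)
  accept : Matrix (Fin dout × Fin danc) (Fin dout × Fin danc) ℂ
  reject : Matrix (Fin dout × Fin danc) (Fin dout × Fin danc) ℂ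
  accept_posSemidef : accept.PosSemidef
  reject_posSemidef : reject.PosSemidef
  accept_add_reject : accept + reject = 1

namespace Tester

variable {din dout n : ℕ}

/-- The state `(M ⊗ I) Vₙ (M ⊗ I) Vₙ₋₁ ⋯ (M ⊗ I) V₁ (|0⟩⟨0|)` that is finally measured. -/
def finalState (T : Tester din dout n) (M : Superop (Fin din) (Fin dout)) :
    Matrix (Fin dout × Fin T.danc) (Fin dout × Fin T.danc) ℂ :=
  Fin.foldl n (fun ρ j => tensorId (Fin T.danc) M (T.V j ρ)) (zeroState dout T.danc)

/-- The probability that the tester accepts when querying `M`. -/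
def acceptProb (T : Tester din dout n) (M : Superop (Fin din) (Fin dout)) : ℝ :=
  (T.accept * T.finalState M).trace.re

/-- The probability that the tester rejects when querying `M`. -/
def rejectProb (T : Tester din dout n) (M : Superop (Fin din) (Fin dout)) : ℝ :=
  (T.reject * T.finalState M).trace.re

end Tester

/-- A randomized tester making `n` queries: a random variable `T` (on some probability space) whose
values are deterministic testers making `n` queries. Convex combinations of deterministic testers
are the case of a finite sample space. Measurability means that each outcome probability is a
measurable function of the sample point. -/
structure RandomizedTester (din dout n : ℕ) where
  Ω : Type*
  [mΩ : MeasurableSpace Ω]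
  μ : MeasureTheory.Measure Ω
  [isProb : MeasureTheory.IsProbabilityMeasure μ]
  T : Ω → Tester din dout n
  measurable_accept : ∀ M : Superop (Fin din) (Fin dout), IsChannel M →
    Measurable fun ω => (T ω).acceptProb M
  measurable_reject : ∀ M : Superop (Fin din) (Fin dout), IsChannel M →
    Measurable fun ω => (T ω).rejectProb M

namespace RandomizedTester

variable {din dout n : ℕ}

/-- The overall probability that the randomized tester accepts when querying `M`. -/
noncomputable def acceptProb (R : RandomizedTester din dout n)
    (M : Superop (Fin din) (Fin dout)) : ℝ :=
  letI := R.mΩ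
  MeasureTheory.integral R.μ fun ω => (R.T ω).acceptProb M

/-- The overall probability that the randomized tester rejects when querying `M`. -/
noncomputable def rejectProb (R : RandomizedTester din dout n)
    (M : Superop (Fin din) (Fin dout)) : ℝ :=
  letI := R.mΩ
  MeasureTheory.integral R.μ fun ω => (R.T ω).rejectProb M

/-- The tester decides, with success probability at least `2/3`, whether the queried channel `M`
satisfies `M = N` (accept) or `‖M - N‖_⋄ ≥ ε` (reject). -/
def Certifies (R : RandomizedTester din dout n) (N : Superop (Fin din) (Fin dout)) (ε : ℝ) : Prop :=
  2 / 3 ≤ R.acceptProb N ∧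
    ∀ M : Superop (Fin din) (Fin dout), IsChannel M → ε ≤ diamondNorm (M - N) →
      2 / 3 ≤ R.rejectProb M

end RandomizedTester

/-!
The lower bound holds because a channel can be altered on one computational basis input without a
tester noticing. For each basis index `i`, let `plant N i b` act as `N` on the complement of `|i⟩`
and send `|i⟩` to `|b⟩`, where `b` is an output on which `N (|i⟩⟨i|)` has weight at most `1 / dout`.
Then `plant N i b - N` has diamond norm at least `2 (1 - 1 / dout)`, so the mixture `perturb N i b p`
of `N` and `plant N i b` with weight `p = ε / (2 (1 - 1 / dout)) ≤ ε` is at distance at least `ε` from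
`N` (`le_diamondNorm_perturb_sub`).

Consider a hybrid argument: replace the `n` uses of `N` by uses of `perturb N i b p` one at a time,
the last one first. Everything after the replaced query is an *effect*, a functional lying between
`0` and the trace on positive matrices, while the state `ρ` entering this query comes from a run with
`N` alone and so does not depend on `i`. With `E = |i⟩⟨i|` and `P = 1 - E`, the operator inequality
`ρ ≤ (1 + t) P ρ P + (1 + t⁻¹) E ρ E` bounds the loss by `p (t + (1 + t⁻¹) qᵢ)`, where `qᵢ` is the
weight of `ρ` on `|i⟩` (`IsEffect.perturb_le`). As `∑ qᵢ = 1`, taking `t = 1 / √din` and summing over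
`i` gives at most `3 p √din` per query (`sum_effect_foldl_sub_le`), whereas a successful tester must
lose at least `1 / 3` for each of the `din` values of `i`. Hence `n ≥ √din / (9 ε)`.
-/

/-! ### The trace norm -/

/-- Testing a matrix against a diagonal contraction bounds its trace norm from below. -/
theorem norm_sum_mul_diag_le_traceNorm {ι : Type*} [Fintype ι] [DecidableEq ι] (B : Matrix ι ι ℂ)
    (u : ι → ℂ) (hu : ∀ j, ‖u j‖ ≤ 1) : ‖∑ j, u j * B j j‖ ≤ traceNorm B := by
  set hH := Matrix.isHermitian_conjTranspose_mul_self B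
  set W : Matrix ι ι ℂ := (hH.eigenvectorUnitary : Matrix ι ι ℂ) with hW
  have hWW : W * W.conjTranspose = 1 := Unitary.mul_star_self_of_mem hH.eigenvectorUnitary.2
  have hWW' : W.conjTranspose * W = 1 := Unitary.star_mul_self_of_mem hH.eigenvectorUnitary.2
  have hcol (i : ι) : ∑ j, ‖W j i‖ ^ 2 = 1 := by
    have h := congrFun (congrFun hWW' i) i
    simp only [Matrix.mul_apply, Matrix.conjTranspose_apply, RCLike.star_def,
      ← Complex.normSq_eq_conj_mul_self, Matrix.one_apply_eq, Complex.normSq_eq_norm_sq] at h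
    exact_mod_cast h
  have hB (i : ι) : ∑ j, ‖(B * W) j i‖ ^ 2 = hH.eigenvalues i := by
    have h : (B * W).conjTranspose * (B * W)
        = Matrix.diagonal (RCLike.ofReal ∘ hH.eigenvalues) := by
      have h1 := hH.conjStarAlgAut_star_eigenvectorUnitary
      rw [Unitary.conjStarAlgAut_star_apply] at h1
      rw [← h1, Matrix.conjTranspose_mul, Matrix.star_eq_conjTranspose]
      simp only [Matrix.mul_assoc, hW]
    have h := congrFun (congrFun h i) i
    simp only [Matrix.mul_apply (M := (B * W).conjTranspose), Matrix.conjTranspose_apply,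
      RCLike.star_def, ← Complex.normSq_eq_conj_mul_self, Matrix.diagonal_apply_eq,
      Complex.normSq_eq_norm_sq, Function.comp_apply] at h
    exact Complex.ofReal_injective ((Complex.ofReal_sum _ _).trans h)
  have htr : ∑ j, u j * B j j = ∑ i, ∑ j, u j * ((B * W) j i * star (W j i)) := by
    rw [Finset.sum_comm]
    refine Finset.sum_congr rfl fun j _ => ?_
    rw [← Finset.mul_sum]
    have h : B j j = ((B * W) * W.conjTranspose) j j := by rw [Matrix.mul_assoc, hWW, mul_one]
    rw [h, Matrix.mul_apply (M := B * W)]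
    rfl
  rw [htr, traceNorm]
  refine (norm_sum_le _ _).trans (Finset.sum_le_sum fun i _ => ?_)
  refine (norm_sum_le _ _).trans ?_
  calc ∑ j, ‖u j * ((B * W) j i * star (W j i))‖ ≤ ∑ j, ‖(B * W) j i‖ * ‖W j i‖ := by
        refine Finset.sum_le_sum fun j _ => ?_
        rw [norm_mul, norm_mul, norm_star]
        exact mul_le_of_le_one_left (by positivity) (hu j)
    _ ≤ √(∑ j, ‖(B * W) j i‖ ^ 2) * √(∑ j, ‖W j i‖ ^ 2) :=
        Real.sum_mul_le_sqrt_mul_sqrt _ _ _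
    _ = √(hH.eigenvalues i) := by rw [hB, hcol]; simp

theorem traceNorm_single_self {ι : Type*} [Fintype ι] [DecidableEq ι] (a : ι) :
    traceNorm (Matrix.single a a (1 : ℂ)) = 1 := by
  have hA : (Matrix.single a a (1 : ℂ)).conjTranspose * Matrix.single a a 1
      = Matrix.single a a 1 := by simp
  have htr : ∑ i, (Matrix.isHermitian_conjTranspose_mul_self
      (Matrix.single a a (1 : ℂ))).eigenvalues i = 1 := by
    rw [sum_eigenvalues_eq_re_trace, hA, Matrix.trace_single_eq_same, Complex.one_re]
  rw [traceNorm, ← htr]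
  refine Finset.sum_congr rfl fun i _ => ?_
  set hH := Matrix.isHermitian_conjTranspose_mul_self (Matrix.single a a (1 : ℂ))
  -- The eigenvalues of a projection are `0` and `1`, so they are their own square roots.
  have hid : IsIdempotentElem
      ((Matrix.single a a (1 : ℂ)).conjTranspose * Matrix.single a a 1) := by
    rw [hA]; simp [IsIdempotentElem]
  have h := hid.spectrum_subset ℝ (hH.eigenvalues_mem_spectrum_real i)
  generalize hH.eigenvalues i = x at h ⊢
  rcases h with rfl | rfl <;> simp

/-! ### Extensions of superoperators by an ancilla -/

/-- Conjugation `X ↦ K X Kᴴ`, the completely positive map with the single Kraus operator `K`. -/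
def conjMap {ι κ : Type*} [Fintype ι] (K : Matrix κ ι ℂ) : Superop ι κ where
  toFun X := K * X * K.conjTranspose
  map_add' X Y := by rw [Matrix.mul_add, Matrix.add_mul]
  map_smul' c X := by simp

theorem tensorId_conjMap {α ι κ : Type*} [Fintype α] [DecidableEq α] [Fintype ι]
    (K : Matrix κ ι ℂ) (X : Matrix (ι × α) (ι × α) ℂ) :
    tensorId α (conjMap K) X
      = (K ⊗ₖ (1 : Matrix α α ℂ)) * X * (K ⊗ₖ (1 : Matrix α α ℂ)).conjTranspose := by
  ext p q
  simp [tensorId, conjMap, Matrix.mul_apply, Fintype.sum_prod_type, Matrix.kroneckerMap_apply,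
    Matrix.one_apply, apply_ite (starRingEnd ℂ)]

theorem posSemidef_tensorId_conjMap {α ι κ : Type*} [Fintype α] [DecidableEq α] [Fintype ι]
    [Fintype κ] (K : Matrix κ ι ℂ) {X : Matrix (ι × α) (ι × α) ℂ} (hX : X.PosSemidef) :
    (tensorId α (conjMap K) X).PosSemidef := by
  rw [tensorId_conjMap]
  exact hX.mul_mul_conjTranspose_same _

theorem IsChannel.posSemidef {ι κ : Type*} [Fintype ι] [Fintype κ] {L : Superop ι κ}
    (hL : IsChannel L) {X : Matrix ι ι ℂ} (hX : X.PosSemidef) : (L X).PosSemidef := by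
  have h := hL.completelyPositive 1 (X.submatrix Prod.fst Prod.fst) (hX.submatrix _)
  exact h.submatrix fun k => (k, 0)

theorem trace_tensorId {α ι κ : Type*} [Fintype α] [Fintype ι] [Fintype κ] {L : Superop ι κ}
    (hL : ∀ X, (L X).trace = X.trace) (X : Matrix (ι × α) (ι × α) ℂ) :
    (tensorId α L X).trace = X.trace := by
  simp only [Matrix.trace, Fintype.sum_prod_type_right]
  exact Finset.sum_congr rfl fun a _ => hL (Matrix.of fun i j => X (i, a) (j, a))

/-! ### Effects -/

/-- An effect: a linear functional that lies between `0` and the trace on positive semidefinite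
matrices. These are the acceptance probabilities of two-outcome measurements. -/
def IsEffect {ι : Type*} [Fintype ι] (f : Matrix ι ι ℂ →ₗ[ℂ] ℂ) : Prop :=
  ∀ X : Matrix ι ι ℂ, X.PosSemidef → 0 ≤ (f X).re ∧ (f X).re ≤ X.trace.re

theorem IsEffect.comp {ι κ : Type*} [Fintype ι] [Fintype κ] {f : Matrix κ κ ℂ →ₗ[ℂ] ℂ}
    (hf : IsEffect f) {L : Superop ι κ} (hpos : ∀ X, X.PosSemidef → (L X).PosSemidef)
    (htr : ∀ X, (L X).trace = X.trace) : IsEffect (f ∘ₗ L) := fun X hX => by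
  have h := hf _ (hpos X hX)
  rwa [htr] at h

theorem IsEffect.comp_tensorId {ι κ : Type*} [Fintype ι] [Fintype κ] {k : ℕ}
    {f : Matrix (κ × Fin k) (κ × Fin k) ℂ →ₗ[ℂ] ℂ} (hf : IsEffect f) {L : Superop ι κ}
    (hL : IsChannel L) : IsEffect (f ∘ₗ tensorId (Fin k) L) :=
  hf.comp (hL.completelyPositive k) (trace_tensorId hL.tracePreserving)

/-- A quantitative gentle measurement bound: splitting `1 = P + E`, an effect loses little when `ρ`
is replaced by `P ρ P`, if the weight of `ρ` on `E` is small. -/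
theorem IsEffect.sub_conj_le {ι : Type*} [Fintype ι] [DecidableEq ι] {f : Matrix ι ι ℂ →ₗ[ℂ] ℂ}
    (hf : IsEffect f) {ρ : Matrix ι ι ℂ} (hρ : ρ.PosSemidef) (E : Matrix ι ι ℂ) {t : ℝ}
    (ht : 0 < t) :
    (f ρ).re - (f ((1 - E) * ρ * (1 - E).conjTranspose)).re
      ≤ t * ((1 - E) * ρ * (1 - E).conjTranspose).trace.re
        + (1 + t⁻¹) * (E * ρ * E.conjTranspose).trace.re := by
  set P := 1 - E with hP
  -- `t (P - t⁻¹ E) ρ (P - t⁻¹ E)ᴴ ≥ 0` says that `ρ ≤ (1 + t) P ρ Pᴴ + (1 + t⁻¹) E ρ Eᴴ`.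
  have h0 := (hf _ (hρ.mul_mul_conjTranspose_same (P - (t⁻¹ : ℂ) • E))).1
  have h1 := (hf _ (hρ.mul_mul_conjTranspose_same P)).2
  have h2 := (hf _ (hρ.mul_mul_conjTranspose_same E)).2
  have hρ' : ρ = P * ρ * P.conjTranspose + P * ρ * E.conjTranspose + E * ρ * P.conjTranspose
      + E * ρ * E.conjTranspose := by
    have hPE : P + E = 1 := by simp [hP]
    calc ρ = (P + E) * ρ * (P + E).conjTranspose := by rw [hPE]; simp
      _ = _ := by rw [Matrix.conjTranspose_add]; noncomm_ring
  have he : (P - (t⁻¹ : ℂ) • E) * ρ * (P - (t⁻¹ : ℂ) • E).conjTranspose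
      = P * ρ * P.conjTranspose
        - ((t⁻¹ : ℝ) : ℂ) • (P * ρ * E.conjTranspose + E * ρ * P.conjTranspose)
        + ((t⁻¹ * t⁻¹ : ℝ) : ℂ) • (E * ρ * E.conjTranspose) := by
    simp [Matrix.conjTranspose_sub, Matrix.sub_mul, Matrix.mul_sub]
    module
  rw [he] at h0
  have hfρ := congrArg (fun X => (f X).re) hρ'
  simp only [map_add, map_sub, map_smul, Complex.add_re, Complex.sub_re, smul_eq_mul,
    Complex.re_ofReal_mul] at h0 hfρ
  have h3 := mul_nonneg ht.le h0
  have htt : t * t⁻¹ = 1 := mul_inv_cancel₀ ht.ne'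
  have h4 : t * ((f (P * ρ * P.conjTranspose)).re
      - t⁻¹ * ((f (P * ρ * E.conjTranspose)).re + (f (E * ρ * P.conjTranspose)).re)
      + t⁻¹ * t⁻¹ * (f (E * ρ * E.conjTranspose)).re)
      = t * (f (P * ρ * P.conjTranspose)).re
      - ((f (P * ρ * E.conjTranspose)).re + (f (E * ρ * P.conjTranspose)).re)
      + t⁻¹ * (f (E * ρ * E.conjTranspose)).re := by
    field_simp
  rw [h4] at h3
  have h5 := mul_le_mul_of_nonneg_left h1 ht.le
  have h6 := mul_le_mul_of_nonneg_left h2 (show 0 ≤ 1 + t⁻¹ by positivity)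
  linarith

/-! ### Channels altered on one basis state -/

/-- The channel acting as `N` on the complement of the basis state `|i⟩` and sending `|i⟩` to `|b⟩`,
with the coherence between the two destroyed. -/
def plant {ι κ : Type*} [Fintype ι] [DecidableEq ι] [DecidableEq κ] (N : Superop ι κ) (i : ι)
    (b : κ) : Superop ι κ :=
  N ∘ₗ conjMap (1 - Matrix.single i i 1) + conjMap (Matrix.single b i 1)

/-- The mixture of `N` with weight `1 - p` and `plant N i b` with weight `p`. -/
noncomputable def perturb {ι κ : Type*} [Fintype ι] [DecidableEq ι] [DecidableEq κ]
    (N : Superop ι κ) (i : ι) (b : κ) (p : ℝ) : Superop ι κ :=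
  ((1 - p : ℝ) : ℂ) • N + (p : ℂ) • plant N i b

theorem tensorId_plant {α ι κ : Type*} [Fintype ι] [DecidableEq ι] [DecidableEq κ]
    (N : Superop ι κ) (i : ι) (b : κ) (X : Matrix (ι × α) (ι × α) ℂ) :
    tensorId α (plant N i b) X
      = tensorId α N (tensorId α (conjMap (1 - Matrix.single i i 1)) X)
        + tensorId α (conjMap (Matrix.single b i 1)) X := rfl

theorem tensorId_perturb {α ι κ : Type*} [Fintype ι] [DecidableEq ι] [DecidableEq κ]
    (N : Superop ι κ) (i : ι) (b : κ) (p : ℝ) (X : Matrix (ι × α) (ι × α) ℂ) :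
    tensorId α (perturb N i b p) X
      = ((1 - p : ℝ) : ℂ) • tensorId α N X + (p : ℂ) • tensorId α (plant N i b) X := rfl

theorem trace_conjMap_one_sub_single {ι : Type*} [Fintype ι] [DecidableEq ι] (i : ι)
    (X : Matrix ι ι ℂ) :
    (conjMap (1 - Matrix.single i i 1) X).trace = X.trace - X i i := by
  have h : (1 - Matrix.single i i (1 : ℂ)).conjTranspose * (1 - Matrix.single i i 1)
      = 1 - Matrix.single i i 1 := by
    simp [Matrix.sub_mul, Matrix.mul_sub]
  change ((1 - Matrix.single i i 1) * X * (1 - Matrix.single i i (1 : ℂ)).conjTranspose).trace = _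
  rw [Matrix.mul_assoc, Matrix.trace_mul_comm, Matrix.mul_assoc, h, Matrix.mul_sub,
    Matrix.trace_sub, mul_one, Matrix.trace_mul_comm, Matrix.trace_single_mul, one_smul]

theorem conjMap_single {ι κ : Type*} [Fintype ι] [DecidableEq ι] [DecidableEq κ] (i : ι) (b : κ)
    (X : Matrix ι ι ℂ) : conjMap (Matrix.single b i 1) X = Matrix.single b b (X i i) := by
  simp [conjMap]

theorem IsChannel.plant {ι κ : Type*} [Fintype ι] [DecidableEq ι] [Fintype κ] [DecidableEq κ]
    {N : Superop ι κ} (hN : IsChannel N) (i : ι) (b : κ) : IsChannel (plant N i b) where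
  completelyPositive k X hX := by
    rw [tensorId_plant]
    exact (hN.completelyPositive k _ (posSemidef_tensorId_conjMap _ hX)).add
      (posSemidef_tensorId_conjMap _ hX)
  tracePreserving X := by
    rw [_root_.plant, LinearMap.add_apply, Matrix.trace_add, LinearMap.comp_apply,
      hN.tracePreserving, trace_conjMap_one_sub_single, conjMap_single,
      Matrix.trace_single_eq_same, sub_add_cancel]

theorem IsChannel.perturb {ι κ : Type*} [Fintype ι] [DecidableEq ι] [Fintype κ] [DecidableEq κ]
    {N : Superop ι κ} (hN : IsChannel N) (i : ι) (b : κ) {p : ℝ} (hp0 : 0 ≤ p) (hp1 : p ≤ 1) :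
    IsChannel (perturb N i b p) where
  completelyPositive k X hX := by
    rw [tensorId_perturb]
    refine ((hN.completelyPositive k X hX).smul ?_).add
      (((hN.plant i b).completelyPositive k X hX).smul ?_)
    · exact Complex.zero_le_real.2 (sub_nonneg.2 hp1)
    · exact Complex.zero_le_real.2 hp0
  tracePreserving X := by
    simp only [_root_.perturb, LinearMap.add_apply, LinearMap.smul_apply, Matrix.trace_add,
      Matrix.trace_smul, hN.tracePreserving, (hN.plant i b).tracePreserving, smul_eq_mul]
    push_cast
    ring

theorem perturb_sub_apply_single {ι κ : Type*} [Fintype ι] [DecidableEq ι] [DecidableEq κ]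
    (N : Superop ι κ) (i : ι) (b : κ) (p : ℝ) :
    (perturb N i b p - N) (Matrix.single i i 1)
      = (p : ℂ) • (Matrix.single b b 1 - N (Matrix.single i i 1)) := by
  have h : conjMap (1 - Matrix.single i i 1) (Matrix.single i i (1 : ℂ)) = 0 := by
    simp [conjMap, Matrix.sub_mul]
  have h' : perturb N i b p (Matrix.single i i 1)
      = ((1 - p : ℝ) : ℂ) • N (Matrix.single i i 1) + (p : ℂ) • Matrix.single b b 1 := by
    simp [perturb, plant, h, conjMap_single]
  rw [LinearMap.sub_apply, h']
  push_cast
  module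

/-- The input `|i⟩⟨i| ⊗ |i⟩⟨i|` and the test whether the output is `|b⟩` witness the distance of
`perturb N i b p` from `N`. -/
theorem le_diamondNorm_perturb_sub {ι κ : Type*} [Fintype ι] [DecidableEq ι] [Fintype κ]
    [DecidableEq κ] {N : Superop ι κ} (hN : IsChannel N) (i : ι) (b : κ) (p : ℝ) :
    2 * p * (1 - (N (Matrix.single i i 1) b b).re) ≤ diamondNorm (perturb N i b p - N) := by
  set D := perturb N i b p - N with hD
  have hX : traceNorm ((Matrix.single i i (1 : ℂ)) ⊗ₖ (Matrix.single i i (1 : ℂ))) ≤ 1 := by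
    rw [Matrix.single_kronecker_single, mul_one]
    exact (traceNorm_single_self _).le
  refine le_trans ?_ (le_csSup (bddAbove_inducedTraceNorm (tensorId ι D)) ⟨_, hX, rfl⟩)
  dsimp only
  rw [tensorId_kronecker, hD, perturb_sub_apply_single]
  set S := N (Matrix.single i i 1) with hS
  have htr : ∑ k, S k k = 1 := by
    have h := hN.tracePreserving (Matrix.single i i 1)
    rwa [Matrix.trace_single_eq_same] at h
  -- The test is the observable `2 |b⟩⟨b| - 1` on the output register.
  refine le_trans ?_ (norm_sum_mul_diag_le_traceNorm _
    (fun x : κ × ι => if x.1 = b then 1 else -1) fun x => by split_ifs <;> simp)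
  refine le_trans (le_of_eq ?_) (Complex.re_le_norm _)
  have hsum : ∑ x : κ × ι, (if x.1 = b then (1 : ℂ) else -1)
      * (((p : ℂ) • (Matrix.single b b 1 - S)) ⊗ₖ Matrix.single i i 1) x x
      = 2 * p * (1 - S b b) := by
    have hsplit (k : κ) : (if k = b then (1 : ℂ) else -1) * (p * (Matrix.single b b 1 k k - S k k))
        = (if k = b then 2 * p * (1 - S b b) - p else 0) + p * S k k := by
      by_cases h : k = b
      · subst h; simp; ring
      · simp [h, Ne.symm h]
    have hone : ∑ a, Matrix.single i i (1 : ℂ) a a = 1 := Matrix.trace_single_eq_same i 1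
    have hprod (x : κ × ι) : (if x.1 = b then (1 : ℂ) else -1)
        * (((p : ℂ) • (Matrix.single b b 1 - S)) ⊗ₖ Matrix.single i i 1) x x
        = (if x.1 = b then (1 : ℂ) else -1) * (p * (Matrix.single b b 1 x.1 x.1 - S x.1 x.1))
          * Matrix.single i i 1 x.2 x.2 := (mul_assoc _ _ _).symm
    simp only [hprod]
    refine (Fintype.sum_prod_type _).trans ((Finset.sum_mul_sum Finset.univ Finset.univ
      (fun k => (if k = b then (1 : ℂ) else -1) * (p * (Matrix.single b b 1 k k - S k k)))
      fun a => Matrix.single i i 1 a a).symm.trans ?_)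
    rw [hone, mul_one]
    simp only [hsplit, Finset.sum_add_distrib, ← Finset.mul_sum, htr]
    simp
  rw [hsum]
  have h : (2 * p * (1 - S b b) : ℂ) = ((2 * p : ℝ) : ℂ) * (1 - S b b) := by push_cast; ring
  rw [h, Complex.re_ofReal_mul]
  simp

/-- Some diagonal entry of a matrix of trace one is at most the inverse of the dimension. -/
theorem exists_diag_re_le_inv_card {κ : Type*} [Fintype κ] [Nonempty κ] {S : Matrix κ κ ℂ}
    (hS : S.trace = 1) : ∃ b, (S b b).re ≤ 1 / (Fintype.card κ : ℝ) := by
  by_contra! h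
  have h1 := Finset.sum_lt_sum_of_nonempty (s := Finset.univ) Finset.univ_nonempty fun b _ => h b
  have h2 : ∑ b, (S b b).re = 1 := by
    rw [← Complex.re_sum]
    exact congrArg Complex.re hS
  rw [h2] at h1
  simp at h1

/-! ### The hybrid argument -/

/-- The loss of an effect when a single query to `N` is replaced by `perturb N i b p`. -/
theorem IsEffect.perturb_le {ι κ : Type*} [Fintype ι] [DecidableEq ι] [Fintype κ] [DecidableEq κ]
    {k : ℕ} {f : Matrix (κ × Fin k) (κ × Fin k) ℂ →ₗ[ℂ] ℂ} (hf : IsEffect f) {N : Superop ι κ}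
    (hN : IsChannel N) {ρ : Matrix (ι × Fin k) (ι × Fin k) ℂ} (hρ : ρ.PosSemidef)
    (hρ1 : ρ.trace = 1) (i : ι) (b : κ) {p t : ℝ} (hp : 0 ≤ p) (ht : 0 < t) :
    (f (tensorId (Fin k) N ρ)).re - (f (tensorId (Fin k) (perturb N i b p) ρ)).re
      ≤ p * (t + (1 + t⁻¹) * ∑ a, (ρ (i, a) (i, a)).re) := by
  set E : Matrix (ι × Fin k) (ι × Fin k) ℂ := Matrix.single i i 1 ⊗ₖ 1 with hE
  have hP : (1 - Matrix.single i i (1 : ℂ)) ⊗ₖ (1 : Matrix (Fin k) (Fin k) ℂ) = 1 - E := by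
    rw [eq_sub_iff_add_eq, hE, ← Matrix.add_kronecker, sub_add_cancel, Matrix.one_kronecker_one]
  have hg := (hf.comp_tensorId hN).sub_conj_le hρ E ht
  have htE : (E * ρ * E.conjTranspose).trace = ∑ a, ρ (i, a) (i, a) := by
    rw [hE, ← tensorId_conjMap]
    simp only [Matrix.trace, Fintype.sum_prod_type_right]
    refine Finset.sum_congr rfl fun a _ => ?_
    change (conjMap (Matrix.single i i 1) (Matrix.of fun x y => ρ (x, a) (y, a))).trace = _
    rw [conjMap_single, Matrix.trace_single_eq_same, Matrix.of_apply]
  have htP : ((1 - E) * ρ * (1 - E).conjTranspose).trace.re ≤ 1 := by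
    have h : ((1 - E) * ρ * (1 - E).conjTranspose).trace
        = ρ.trace - (E * ρ * E.conjTranspose).trace := by
      rw [htE, ← hP, ← tensorId_conjMap]
      simp only [Matrix.trace, Fintype.sum_prod_type_right, ← Finset.sum_sub_distrib]
      exact Finset.sum_congr rfl fun a _ =>
        trace_conjMap_one_sub_single i (Matrix.of fun x y => ρ (x, a) (y, a))
    have h' : 0 ≤ (E * ρ * E.conjTranspose).trace.re :=
      (Complex.nonneg_iff.1 (hρ.mul_mul_conjTranspose_same E).trace_nonneg).1
    rw [h, hρ1, Complex.sub_re, Complex.one_re]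
    linarith
  have hplant : (f (tensorId (Fin k) N ρ)).re - (f (tensorId (Fin k) (plant N i b) ρ)).re
      ≤ t + (1 + t⁻¹) * ∑ a, (ρ (i, a) (i, a)).re := by
    have h0 := (hf _ (posSemidef_tensorId_conjMap (Matrix.single b i 1) hρ)).1
    rw [htE, Complex.re_sum] at hg
    simp only [LinearMap.comp_apply] at hg
    rw [tensorId_plant, map_add, Complex.add_re, tensorId_conjMap (1 - Matrix.single i i 1), hP]
    have := mul_le_mul_of_nonneg_left htP ht.le
    linarith
  have h := mul_le_mul_of_nonneg_left hplant hp
  rw [tensorId_perturb, map_add, map_smul, map_smul, smul_eq_mul, smul_eq_mul, Complex.add_re,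
    Complex.re_ofReal_mul, Complex.re_ofReal_mul]
  linarith

/-- The states reached by a tester that queries a channel are density matrices. -/
theorem density_foldl {din dout k n : ℕ}
    (V : Fin n → Superop (Fin dout × Fin k) (Fin din × Fin k)) (hV : ∀ j, IsChannel (V j))
    {M : Superop (Fin din) (Fin dout)} (hM : IsChannel M)
    {ρ₀ : Matrix (Fin dout × Fin k) (Fin dout × Fin k) ℂ} (h₀ : ρ₀.PosSemidef)
    (h₁ : ρ₀.trace = 1) :
    (Fin.foldl n (fun ρ j => tensorId (Fin k) M (V j ρ)) ρ₀).PosSemidef ∧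
      (Fin.foldl n (fun ρ j => tensorId (Fin k) M (V j ρ)) ρ₀).trace = 1 := by
  induction n with
  | zero => simpa using ⟨h₀, h₁⟩
  | succ n ih =>
    rw [Fin.foldl_succ_last]
    obtain ⟨ih0, ih1⟩ := ih (fun j => V j.castSucc) fun j => hV _
    exact ⟨hM.completelyPositive k _ ((hV _).posSemidef ih0), by
      rw [trace_tensorId hM.tracePreserving, (hV _).tracePreserving, ih1]⟩

/-- The hybrid argument. The effects `f i` may depend on the planted index `i`, as they absorb the
queries made to the altered channel after the one that is being replaced. -/
theorem sum_effect_foldl_sub_le {din dout k n : ℕ} (hd : 0 < din)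
    (V : Fin n → Superop (Fin dout × Fin k) (Fin din × Fin k)) (hV : ∀ j, IsChannel (V j))
    {N : Superop (Fin din) (Fin dout)} (hN : IsChannel N)
    {ρ₀ : Matrix (Fin dout × Fin k) (Fin dout × Fin k) ℂ} (h₀ : ρ₀.PosSemidef)
    (h₁ : ρ₀.trace = 1) (b : Fin din → Fin dout) {p : ℝ} (hp0 : 0 ≤ p) (hp1 : p ≤ 1)
    (f : Fin din → Matrix (Fin dout × Fin k) (Fin dout × Fin k) ℂ →ₗ[ℂ] ℂ)
    (hf : ∀ i, IsEffect (f i)) :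
    ∑ i, ((f i (Fin.foldl n (fun ρ j => tensorId (Fin k) N (V j ρ)) ρ₀)).re
      - (f i (Fin.foldl n
          (fun ρ j => tensorId (Fin k) (perturb N i (b i) p) (V j ρ)) ρ₀)).re)
      ≤ n * (3 * p * √din) := by
  induction n generalizing f with
  | zero => simp
  | succ n ih =>
    simp only [Fin.foldl_succ_last]
    have hM (i) : IsChannel (perturb N i (b i) p) := hN.perturb i (b i) hp0 hp1
    obtain ⟨hσ0, hσ1⟩ := density_foldl (fun j => V j.castSucc) (fun j => hV _) hN h₀ h₁
    have hih := ih (fun j => V j.castSucc) (fun j => hV _)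
      (fun i => (f i ∘ₗ tensorId (Fin k) (perturb N i (b i) p)) ∘ₗ V (Fin.last n))
      fun i => ((hf i).comp_tensorId (hM i)).comp (fun X hX => (hV _).posSemidef hX)
        (hV _).tracePreserving
    simp only [LinearMap.comp_apply] at hih
    set σ := Fin.foldl n (fun ρ j => tensorId (Fin k) N (V j.castSucc ρ)) ρ₀
    have hτ0 : (V (Fin.last n) σ).PosSemidef := (hV _).posSemidef hσ0
    have hτ1 : (V (Fin.last n) σ).trace = 1 := by rw [(hV _).tracePreserving, hσ1]
    set τ := V (Fin.last n) σ
    have hs : 1 ≤ √(din : ℝ) := Real.one_le_sqrt.2 (by exact_mod_cast hd)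
    have hstep := Finset.sum_le_sum fun i (_ : i ∈ Finset.univ) =>
      (hf i).perturb_le hN hτ0 hτ1 i (b i) hp0 (t := (√(din : ℝ))⁻¹) (by positivity)
    have htr : ∑ i, ∑ a, (τ (i, a) (i, a)).re = 1 := by
      have h := congrArg Complex.re hτ1
      rwa [Matrix.trace, Complex.re_sum, Fintype.sum_prod_type] at h
    rw [← Finset.mul_sum, Finset.sum_add_distrib, ← Finset.mul_sum, htr, inv_inv, mul_one,
      Finset.sum_const, Finset.card_univ, Fintype.card_fin, nsmul_eq_mul] at hstep
    have hdiv : (din : ℝ) * (√(din : ℝ))⁻¹ = √din := by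
      rw [← div_eq_mul_inv, Real.div_sqrt]
    rw [hdiv] at hstep
    have hb : p * (√(din : ℝ) + (1 + √din)) ≤ 3 * p * √din := by
      have := mul_le_mul_of_nonneg_left hs hp0
      linarith
    rw [Finset.sum_sub_distrib] at hih hstep ⊢
    push_cast
    linarith

/-! ### Testers -/

namespace Tester

variable {din dout n : ℕ}

open scoped MatrixOrder in
theorem isEffect_accept (T : Tester din dout n) :
    IsEffect (Matrix.traceLinearMap _ ℂ ℂ ∘ₗ LinearMap.mulLeft ℂ T.accept) := fun X hX => by
  have key {A : Matrix (Fin dout × Fin T.danc) (Fin dout × Fin T.danc) ℂ} (hA : A.PosSemidef) :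
      0 ≤ (A * X).trace.re := by
    obtain ⟨B, rfl⟩ := CStarAlgebra.nonneg_iff_eq_star_mul_self.1 hA.nonneg
    rw [Matrix.mul_assoc, Matrix.trace_mul_comm]
    exact (Complex.nonneg_iff.1 (hX.mul_mul_conjTranspose_same B).trace_nonneg).1
  have h : (T.accept * X).trace + (T.reject * X).trace = X.trace := by
    rw [← Matrix.trace_add, ← Matrix.add_mul, T.accept_add_reject, one_mul]
  refine ⟨key T.accept_posSemidef, ?_⟩
  change (T.accept * X).trace.re ≤ _
  have := key T.reject_posSemidef
  rw [← h, Complex.add_re]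
  linarith

theorem zeroState_eq_single {danc : ℕ} (hd : 0 < dout) (ha : 0 < danc) :
    zeroState dout danc = Matrix.single (⟨0, hd⟩, ⟨0, ha⟩) (⟨0, hd⟩, ⟨0, ha⟩) 1 := by
  ext ⟨x, y⟩ ⟨z, w⟩
  simp only [zeroState, Matrix.of_apply, Matrix.single_apply, Prod.mk.injEq, Fin.ext_iff]
  congr 1
  simp only [eq_comm, and_assoc]

theorem zeroState_posSemidef {danc : ℕ} (hd : 0 < dout) (ha : 0 < danc) :
    (zeroState dout danc).PosSemidef := by
  rw [zeroState_eq_single hd ha]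
  have h := Matrix.posSemidef_conjTranspose_mul_self
    (Matrix.single ((⟨0, hd⟩, ⟨0, ha⟩) : Fin dout × Fin danc)
      ((⟨0, hd⟩, ⟨0, ha⟩) : Fin dout × Fin danc) (1 : ℂ))
  rwa [Matrix.conjTranspose_single, Matrix.single_mul_single_same, star_one, mul_one] at h

theorem trace_zeroState {danc : ℕ} (hd : 0 < dout) (ha : 0 < danc) :
    (zeroState dout danc).trace = 1 := by
  rw [zeroState_eq_single hd ha, Matrix.trace_single_eq_same]

theorem density_finalState (T : Tester din dout n) (hd : 0 < dout)
    {M : Superop (Fin din) (Fin dout)} (hM : IsChannel M) :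
    (T.finalState M).PosSemidef ∧ (T.finalState M).trace = 1 :=
  density_foldl T.V T.V_channel hM (zeroState_posSemidef hd T.danc_pos)
    (trace_zeroState hd T.danc_pos)

theorem acceptProb_mem_Icc (T : Tester din dout n) (hd : 0 < dout)
    {M : Superop (Fin din) (Fin dout)} (hM : IsChannel M) : T.acceptProb M ∈ Set.Icc 0 1 := by
  obtain ⟨h0, h1⟩ := T.density_finalState hd hM
  have h := T.isEffect_accept _ h0
  rw [h1] at h
  exact h

theorem rejectProb_eq (T : Tester din dout n) (hd : 0 < dout)
    {M : Superop (Fin din) (Fin dout)} (hM : IsChannel M) :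
    T.rejectProb M = 1 - T.acceptProb M := by
  rw [eq_sub_iff_add_eq', acceptProb, rejectProb, ← Complex.add_re, ← Matrix.trace_add,
    ← Matrix.add_mul, T.accept_add_reject, one_mul, (T.density_finalState hd hM).2, Complex.one_re]

theorem sum_acceptProb_sub_le (T : Tester din dout n) (hdin : 0 < din) (hdout : 0 < dout)
    {N : Superop (Fin din) (Fin dout)} (hN : IsChannel N) (b : Fin din → Fin dout) {p : ℝ}
    (hp0 : 0 ≤ p) (hp1 : p ≤ 1) :
    ∑ i, (T.acceptProb N - T.acceptProb (perturb N i (b i) p)) ≤ n * (3 * p * √din) :=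
  sum_effect_foldl_sub_le hdin T.V T.V_channel hN (zeroState_posSemidef hdout T.danc_pos)
    (trace_zeroState hdout T.danc_pos) b hp0 hp1 _ fun _ => T.isEffect_accept

end Tester

namespace RandomizedTester

variable {din dout n : ℕ}

theorem integrable_acceptProb (R : RandomizedTester din dout n) (hd : 0 < dout)
    {M : Superop (Fin din) (Fin dout)} (hM : IsChannel M) :
    letI := R.mΩ
    MeasureTheory.Integrable (fun ω => (R.T ω).acceptProb M) R.μ := by
  let _ := R.mΩ
  have := R.isProb
  refine MeasureTheory.Integrable.of_mem_Icc 0 1 (R.measurable_accept M hM).aemeasurable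
    (Filter.Eventually.of_forall fun ω => (R.T ω).acceptProb_mem_Icc hd hM)

theorem rejectProb_eq (R : RandomizedTester din dout n) (hd : 0 < dout)
    {M : Superop (Fin din) (Fin dout)} (hM : IsChannel M) :
    R.rejectProb M = 1 - R.acceptProb M := by
  let _ := R.mΩ
  have := R.isProb
  simp only [rejectProb, acceptProb, (R.T _).rejectProb_eq hd hM]
  rw [MeasureTheory.integral_sub (MeasureTheory.integrable_const 1)
    (R.integrable_acceptProb hd hM)]
  simp

theorem sum_acceptProb_sub_le (R : RandomizedTester din dout n) (hdin : 0 < din)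
    (hdout : 0 < dout) {N : Superop (Fin din) (Fin dout)} (hN : IsChannel N)
    (b : Fin din → Fin dout) {p : ℝ} (hp0 : 0 ≤ p) (hp1 : p ≤ 1) :
    ∑ i, (R.acceptProb N - R.acceptProb (perturb N i (b i) p)) ≤ n * (3 * p * √din) := by
  let _ := R.mΩ
  have := R.isProb
  have hi (i) : MeasureTheory.Integrable (fun ω => (R.T ω).acceptProb N
      - (R.T ω).acceptProb (perturb N i (b i) p)) R.μ := (R.integrable_acceptProb hdout hN).sub
    (R.integrable_acceptProb hdout (hN.perturb i (b i) hp0 hp1))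
  have h : ∑ i, (R.acceptProb N - R.acceptProb (perturb N i (b i) p))
      = MeasureTheory.integral R.μ fun ω =>
        ∑ i, ((R.T ω).acceptProb N - (R.T ω).acceptProb (perturb N i (b i) p)) := by
    rw [MeasureTheory.integral_finsetSum _ fun i _ => hi i]
    exact Finset.sum_congr rfl fun i _ => (MeasureTheory.integral_sub
      (R.integrable_acceptProb hdout hN)
      (R.integrable_acceptProb hdout (hN.perturb i (b i) hp0 hp1))).symm
  rw [h]
  refine (MeasureTheory.integral_mono (MeasureTheory.integrable_finsetSum _ fun i _ => hi i)
    (MeasureTheory.integrable_const _) fun ω =>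
      (R.T ω).sum_acceptProb_sub_le hdin hdout hN b hp0 hp1).trans_eq ?_
  simp

end RandomizedTester

theorem theorem1p1 :
    ∃ c : ℝ, 0 < c ∧
      ∀ (din dout : ℕ), 2 ≤ dout →
      ∀ N : Superop (Fin din) (Fin dout), IsChannel N →
      ∀ ε : ℝ, 0 < ε → ε ≤ 2 * (1 - 1 / (dout : ℝ)) →
      ∀ (n : ℕ) (R : RandomizedTester din dout n), R.Certifies N ε →
        c * (Real.sqrt din / ε) ≤ (n : ℝ) := by
  refine ⟨1 / 9, by norm_num, fun din dout hdout N hN ε hε0 hε n R hR => ?_⟩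
  obtain rfl | hdin := Nat.eq_zero_or_pos din
  · simp
  have hdpos : 0 < dout := by omega
  have : Nonempty (Fin dout) := ⟨⟨0, hdpos⟩⟩
  have hhalf : 1 / (dout : ℝ) ≤ 1 / 2 :=
    one_div_le_one_div_of_le two_pos (by exact_mod_cast hdout)
  set δ : ℝ := 2 * (1 - 1 / (dout : ℝ)) with hδ
  have hδ1 : 1 ≤ δ := by rw [hδ]; linarith
  set p := ε / δ with hp
  have hp0 : 0 ≤ p := by positivity
  have hp1 : p ≤ 1 := div_le_one_of_le₀ hε (by positivity)
  have hpε : p ≤ ε := div_le_self hε0.le hδ1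
  have hex (i : Fin din) := exists_diag_re_le_inv_card (S := N (Matrix.single i i 1))
    (by rw [hN.tracePreserving, Matrix.trace_single_eq_same])
  choose b hb using hex
  have hfar (i : Fin din) : ε ≤ diamondNorm (perturb N i (b i) p - N) := by
    refine le_trans ?_ (le_diamondNorm_perturb_sub hN i (b i) p)
    have h1 := hb i
    rw [Fintype.card_fin] at h1
    have h2 : ε = p * δ := (div_mul_cancel₀ ε (by positivity)).symm
    have h3 := mul_le_mul_of_nonneg_left h1 hp0
    rw [h2, hδ]
    linarith
  have hgap (i : Fin din) :
      1 / 3 ≤ R.acceptProb N - R.acceptProb (perturb N i (b i) p) := by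
    have hM := hN.perturb i (b i) hp0 hp1
    have h1 := hR.1
    have h2 := hR.2 _ hM (hfar i)
    rw [R.rejectProb_eq hdpos hM] at h2
    linarith
  have hlow := (Finset.sum_le_sum fun i (_ : i ∈ Finset.univ) => hgap i).trans
    (R.sum_acceptProb_sub_le hdin hdpos hN b hp0 hp1)
  rw [Finset.sum_const, Finset.card_univ, Fintype.card_fin, nsmul_eq_mul] at hlow
  have hs : 0 < √(din : ℝ) := Real.sqrt_pos.2 (by exact_mod_cast hdin)
  have hs2 : √(din : ℝ) * √(din : ℝ) = din := Real.mul_self_sqrt (Nat.cast_nonneg _)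
  have hkey : √(din : ℝ) ≤ 9 * n * p := by
    refine le_of_mul_le_mul_right ?_ hs
    linarith
  have hkey' : √(din : ℝ) ≤ 9 * n * ε :=
    hkey.trans (mul_le_mul_of_nonneg_left hpε (by positivity))
  have : √(din : ℝ) / ε ≤ 9 * n := (div_le_iff₀ hε0).2 hkey'
  linarith
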